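/- Let $(V,\circ,e)$ be a Euclidean Jordan algebra with identity, i.e. a finite-dimensional real vector space with a commutative bilinear product $\circ$ such that $x\circ(x^2\circ y)=x^2\circ(x\circ y)$ (where $x^2=x\circ x$) and $x\circ e=x$ for all $x,y\in V$, and such that $V$ admits an associative positive definite bilinear form. Let $r$ be its rank, i.e. the smallest integer such that $e,x,\dots,x^r$ are linearly dependent for all $x\in V$. Every $x\in V$ has a spectral decomposition $x=\sum_{i=1}^r\lambda_i(x)c_i$ with a Jordan frame $c_1,\dots,c_r$; put $\operatorname{trace}(x)=\sum_i\lambda_i(x)$, $\|x\|=\max_i|\lambda_i(x)|$, and endow $V$ with the trace inner product $\langle x,y\rangle=\operatorname{trace}(x\circ y)$ and the norm $\|x\|_F=\sqrt{\langle x,x\rangle}$. Let $\Omega$ be the interior of the cone of squares $\{x^2:x\in V\}$, let $v^+$ be the projection of $v\in V$ on $\bar\Omega$, and let $\Delta(\Omega)=\{x\in\bar\Omega:\langle e,x\rangle=1\}$. Let $P:V\to V$ be the orthogonal projection onto a linear subspace $L\subseteq V$. The von Neumann scheme with a given stopping condition is the following procedure. Pick any $z_0\in\Delta(\Omega)$.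 For $t=0,1,2,\dots$, as long as $z_t$ does not satisfy the stopping condition, choose $$u_t\in\operatorname*{argmin}_{u\in\Delta(\Omega)}\langle u,Pz_t\rangle,\qquad \theta_t\in\operatorname*{argmin}_{\theta\in[0,1]}\|P(z_t+\theta(u_t-z_t))\|_F^2,$$ and let $z_{t+1}=z_t+\theta_t(u_t-z_t)$. (i) With the stopping condition "$Pz\in\Omega$ or $\|(Pz)^+\|_F\le\frac1{4r}\|z\|$", the scheme reaches this condition after at most $(4r^2)^2=16r^4$ iterations, i.e. it holds for $z=z_t$ for some $t\le 16r^4$. (ii) In the special case $V=\mathbb R^n$ with the componentwise product (so $\bar\Omega=\mathbb R^n_+$, $\Delta(\Omega)$ is the standard simplex, $\langle\cdot,\cdot\rangle$ is the usual inner product and $v^+$ is the componentwise positive part), with the stopping condition "$Pz>0$ componentwise or $\|(Pz)^+\|_2\le\frac1{3\sqrt n}\|z\|_\infty$", the scheme reaches this condition after at most $(3n\sqrt n)^2=9n^3$ iterations. -/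

import Mathlib

open Set

noncomputable section

/-- A Euclidean Jordan algebra with identity element: a real vector space with a bilinear
product `mul` (written `∘` below) and a distinguished element `one` (written `e`). -/
structure EuclideanJordanAlgebra (V : Type*) [AddCommGroup V] [Module ℝ V] where
  /-- the bilinear product `x ∘ y` -/
  mul : V →ₗ[ℝ] V →ₗ[ℝ] V
  /-- the identity element `e` -/
  one : V
  mul_comm : ∀ x y : V, mul x y = mul y x
  jordan : ∀ x y : V, mul x (mul (mul x x) y) = mul (mul x x) (mul x y)
  mul_one : ∀ x : V, mul x one = x
  exists_form : ∃ B : V →ₗ[ℝ] V →ₗ[ℝ] ℝ,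
    (∀ x y z : V, B (mul x y) z = B x (mul y z)) ∧ ∀ x : V, x ≠ 0 → 0 < B x x

namespace EuclideanJordanAlgebra

section Algebra

variable {V : Type*} [AddCommGroup V] [Module ℝ V] (J : EuclideanJordanAlgebra V)

/-- Powers: `x ^ 0 = e` and `x ^ (k + 1) = x ∘ x ^ k`. -/
def pow (x : V) : ℕ → V
  | 0 => J.one
  | k + 1 => J.mul x (pow x k)

/-- The rank: the smallest `r` such that `e, x, x ^ 2, …, x ^ r` are linearly dependent
for every `x`. -/
def rank : ℕ :=
  sInf {r : ℕ | ∀ x : V, ¬ LinearIndependent ℝ (fun i : Fin (r + 1) => J.pow x i)}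

def IsIdempotent (c : V) : Prop := J.mul c c = c

/-- An idempotent that is not the sum of two other idempotents. -/
def IsPrimitiveIdempotent (c : V) : Prop :=
  J.IsIdempotent c ∧
    ¬ ∃ a b : V, J.IsIdempotent a ∧ J.IsIdempotent b ∧ a ≠ c ∧ b ≠ c ∧ a + b = c

/-- A Jordan frame `c₁, …, c_r`, with `r` the rank. -/
structure IsJordanFrame (c : Fin J.rank → V) : Prop where
  ne_zero : ∀ i, c i ≠ 0
  primitive : ∀ i, J.IsPrimitiveIdempotent (c i)
  orthogonal : ∀ i j, i ≠ j → J.mul (c i) (c j) = 0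
  sum_eq_one : ∑ i, c i = J.one

/-- `x = ∑ i, lam i • c i` is a spectral decomposition of `x`. -/
def IsSpectralDecomposition (x : V) (lam : Fin J.rank → ℝ) (c : Fin J.rank → V) : Prop :=
  J.IsJordanFrame c ∧ x = ∑ i, lam i • c i

open Classical in
/-- The vector of eigenvalues of `x`, read off from a spectral decomposition of `x`.
(In finite dimension a spectral decomposition always exists, and the eigenvalues are unique up to
their order, on which nothing below depends.) -/
def eigenvalues (x : V) : Fin J.rank → ℝ :=
  if h : ∃ lam : Fin J.rank → ℝ, ∃ c : Fin J.rank → V, J.IsSpectralDecomposition x lam c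
  then h.choose else 0

/-- The trace: the sum of the eigenvalues. -/
def trace (x : V) : ℝ := ∑ i, J.eigenvalues x i

/-- The operator norm `‖x‖ = ‖λ(x)‖_∞`; the norm on `Fin r → ℝ` is the maximum norm. -/
def opNorm (x : V) : ℝ := ‖J.eigenvalues x‖

end Algebra

section Cone

variable {V : Type*} [NormedAddCommGroup V] [InnerProductSpace ℝ V]
  (J : EuclideanJordanAlgebra V)

/-- `Ω`, the interior of the cone of squares. -/
def openCone : Set V := interior {y : V | ∃ x : V, y = J.mul x x}

/-- The spectraplex `Δ(Ω)`: the points `x` of the closure of `Ω` with `⟨e, x⟩ = 1`. -/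
def spectraplex : Set V := {x : V | x ∈ closure J.openCone ∧ inner ℝ J.one x = 1}

open Classical in
/-- `v⁺`, the projection of `v` on the closure of `Ω`, that is, the point of the closure
of `Ω` nearest to `v`. -/
def posPart (v : V) : V :=
  if h : ∃ p ∈ closure J.openCone, ∀ q ∈ closure J.openCone, ‖v - p‖ ≤ ‖v - q‖
  then h.choose else 0

end Cone

/-- The algebra `ℝⁿ` with the componentwise product. Its identity element is the all-ones vector,
its cone of squares is the nonnegative orthant, and its trace inner product is the usual inner
product of `ℝⁿ`. -/
def orthant (n : ℕ) : EuclideanJordanAlgebra (EuclideanSpace ℝ (Fin n)) where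
  mul := LinearMap.mk₂ ℝ
    (fun x y => WithLp.toLp 2 (fun i => x i * y i))
    (fun x y z => by ext i; simp [add_mul])
    (fun a x y => by ext i; simp [mul_assoc])
    (fun x y z => by ext i; simp [mul_add])
    (fun a x y => by ext i; simp [mul_left_comm])
  one := WithLp.toLp 2 (fun _ => 1)
  mul_comm x y := by ext i; simp [_root_.mul_comm]
  jordan x y := by ext i; simp; ring
  mul_one x := by ext i; simp
  exists_form := by
    refine ⟨innerₗ (EuclideanSpace ℝ (Fin n)), fun x y z => ?_, fun x hx => ?_⟩
    · simp only [innerₗ_apply_apply, PiLp.inner_apply, LinearMap.mk₂_apply]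
      refine Finset.sum_congr rfl fun i _ => ?_
      simp; ring
    · rw [innerₗ_apply_apply]
      exact real_inner_self_pos.mpr hx

end EuclideanJordanAlgebra

/-- The iterates of the von Neumann scheme for the map `P` over the set `Δ`, with an arbitrary
stopping condition `halts`: start anywhere in `Δ`, and, as long as the current iterate does not meet
the stopping condition, let `u` be a minimizer over `Δ` of `⟨u, P z_t⟩`, let `θ` be a
minimizer over `[0, 1]` of `‖P (z_t + θ (u - z_t))‖²`, and put `z_{t+1} = z_t + θ (u - z_t)`.
What `z` does after the stopping condition has been met is left unconstrained. -/
structure IsVonNeumannRun {E : Type*} [NormedAddCommGroup E] [InnerProductSpace ℝ E]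
    (Δ : Set E) (P : E → E) (halts : E → Prop) (z : ℕ → E) : Prop where
  init : z 0 ∈ Δ
  step : ∀ t : ℕ, ¬ halts (z t) → ∃ u ∈ Δ, ∃ θ ∈ Icc (0 : ℝ) 1,
    IsMinOn (fun w : E => inner ℝ w (P (z t))) Δ u ∧
    IsMinOn (fun s : ℝ => ‖P (z t + s • (u - z t))‖ ^ 2) (Icc (0 : ℝ) 1) θ ∧
    z (t + 1) = z t + θ • (u - z t)

/-- The stopping condition `P z ∈ Ω` or `‖(P z)⁺‖_F ≤ ‖z‖ / (4 r)`. -/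
def SymmetricStop {V : Type*} [NormedAddCommGroup V] [InnerProductSpace ℝ V]
    (J : EuclideanJordanAlgebra V) (P : V → V) (z : V) : Prop :=
  P z ∈ J.openCone ∨ ‖J.posPart (P z)‖ ≤ 1 / (4 * (J.rank : ℝ)) * J.opNorm z

/-- The stopping condition `P z > 0` or `‖(P z)⁺‖₂ ≤ ‖z‖_∞ / (3 √n)` in `ℝⁿ`, where
`v⁺` is the componentwise positive part. -/
def OrthantStop {n : ℕ} (P : EuclideanSpace ℝ (Fin n) → EuclideanSpace ℝ (Fin n))
    (z : EuclideanSpace ℝ (Fin n)) : Prop :=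
  (∀ i, 0 < P z i) ∨
    ‖(WithLp.toLp 2 (fun i => max (P z i) 0) : EuclideanSpace ℝ (Fin n))‖ ≤
      1 / (3 * √(n : ℝ)) * ‖WithLp.ofLp z‖

end

namespace EuclideanJordanAlgebra

/-! ### Idempotents, squares and Jordan frames -/

section Algebra

variable {V : Type*} [AddCommGroup V] [Module ℝ V] (J : EuclideanJordanAlgebra V)

/-! As long as the scheme has not halted, `P z ∉ Ω`, so the minimizer `u` satisfies `⟨P z, P u⟩ ≤
0`: a positive minimum of `⟨·, P z⟩` over `Δ(Ω)` would force `P z ∈ Ω`. Since `Δ(Ω)` lies in the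
unit ball, the classical von Neumann estimate gives `‖P z_t‖² ≤ 1 / (t + 1)`
(`IsVonNeumannRun.norm_sq_le`). Projection on the cone does not increase the norm, and trace `1`
forces `‖z‖ ≥ 1 / r`, so the second stopping test holds once `‖P z‖ ≤ 1 / (4 r²)`, respectively `1 /
(3 n √n)` in the orthant.

The remaining work is the geometry of the cone. The set of squares is the dual, under an associative
form `B`, of the set of idempotents (`mem_squares_iff`), hence closed and convex. Associativity of
the trace product is never needed. Neither is `trace c = 1` for frame elements: the bound `trace c ≥
1` for nonzero idempotents (`IsIdempotent.one_le_inner`) suffices for the norm and interior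
estimates. -/

/-- The set of squares of a Euclidean Jordan algebra. -/
def squares : Set V := {y : V | ∃ x : V, y = J.mul x x}

variable {J}

/-- The Peirce polynomial `2 t ^ 3 - 3 t ^ 2 + t` annihilates multiplication by an idempotent. -/
theorem IsIdempotent.peirce {c : V} (hc : J.IsIdempotent c) (z : V) :
    (2 : ℝ) • J.mul c (J.mul c (J.mul c z)) + J.mul c z = (3 : ℝ) • J.mul c (J.mul c z) := by
  -- The difference of the Jordan identities at `c + z` and `c - z` keeps the terms odd in `z`; the
  -- cubic ones cancel against the identity at `z`.
  have hc' : J.mul c c = c := hc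
  have h₁ := J.jordan (c + z) c
  have h₂ := J.jordan (c - z) c
  have h₃ := J.jordan z c
  simp only [map_add, map_sub, LinearMap.add_apply, LinearMap.sub_apply, hc',
    J.mul_comm z c, J.mul_comm (J.mul c z) c, J.mul_comm (J.mul z z) c] at h₁ h₂ h₃
  linear_combination (norm := module) (1 / 2 : ℝ) • h₁ - (1 / 2 : ℝ) • h₂ - h₃

/-- An associative positive definite form is nonnegative between squares and idempotents. -/
theorem IsIdempotent.form_sq_nonneg {c : V} (hc : J.IsIdempotent c) {B : V →ₗ[ℝ] V →ₗ[ℝ] ℝ}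
    (hB : ∀ x y z : V, B (J.mul x y) z = B x (J.mul y z)) (hpos : ∀ x : V, x ≠ 0 → 0 < B x x)
    (x : V) : 0 ≤ B (J.mul x x) c := by
  have hnn : ∀ y, 0 ≤ B y y := fun y => by
    rcases eq_or_ne y 0 with rfl | hy
    · simp
    · exact (hpos y hy).le
  have hsa : ∀ y w, B y (J.mul c w) = B (J.mul c y) w := fun y w => by
    rw [J.mul_comm c y, hB]
  -- With `T` the multiplication by `c`, self-adjoint for `B`, the Peirce relation gives `T = T² + 4
  -- (T - T²)²`, a sum of squares.
  have h₁ := congrArg (fun w => B x w) (hc.peirce x)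
  have h₂ := congrArg (fun w => B x w) (hc.peirce (J.mul c x))
  have h₃ := hnn (J.mul c x)
  have h₄ := hnn (J.mul c x - J.mul c (J.mul c x))
  rw [hB, J.mul_comm x c]
  simp only [map_add, map_sub, map_smul, LinearMap.sub_apply, smul_eq_mul, hsa] at *
  linarith

theorem IsJordanFrame.mul_eq {c : Fin J.rank → V} (hc : J.IsJordanFrame c) (i j : Fin J.rank) :
    J.mul (c i) (c j) = if i = j then c i else 0 := by
  split_ifs with h
  · subst h; exact (hc.primitive i).1
  · exact hc.orthogonal i j h

theorem IsJordanFrame.sum_mul_sum {c : Fin J.rank → V} (hc : J.IsJordanFrame c)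
    (a b : Fin J.rank → ℝ) :
    J.mul (∑ i, a i • c i) (∑ i, b i • c i) = ∑ i, (a i * b i) • c i := by
  simp only [map_sum, LinearMap.sum_apply, map_smul, LinearMap.smul_apply, hc.mul_eq, smul_ite,
    smul_zero, Finset.sum_ite_eq', Finset.mem_univ, if_true, smul_smul, _root_.mul_comm (b _)]

theorem IsJordanFrame.mem_squares {c : Fin J.rank → V} (hc : J.IsJordanFrame c)
    {a : Fin J.rank → ℝ} (ha : ∀ i, 0 ≤ a i) : ∑ i, a i • c i ∈ J.squares := by
  refine ⟨∑ i, √(a i) • c i, ?_⟩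
  rw [hc.sum_mul_sum]
  simp only [Real.mul_self_sqrt (ha _)]

theorem IsIdempotent.mem_squares {c : V} (hc : J.IsIdempotent c) : c ∈ J.squares := ⟨c, hc.symm⟩

theorem smul_mem_squares {x : V} (hx : x ∈ J.squares) {a : ℝ} (ha : 0 ≤ a) :
    a • x ∈ J.squares := by
  obtain ⟨y, rfl⟩ := hx
  refine ⟨√a • y, ?_⟩
  simp only [map_smul, LinearMap.smul_apply, smul_smul, Real.mul_self_sqrt ha]

theorem isIdempotent_one (J : EuclideanJordanAlgebra V) : J.IsIdempotent J.one := J.mul_one J.one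

/-- The default eigenvalue vector is `0`, so a nonzero trace certifies that a spectral decomposition
exists. -/
theorem exists_isSpectralDecomposition_of_trace_ne_zero {x : V} (hx : J.trace x ≠ 0) :
    J.IsSpectralDecomposition x (J.eigenvalues x)
      (Classical.epsilon fun c => J.IsSpectralDecomposition x (J.eigenvalues x) c) := by
  apply Classical.epsilon_spec (p := fun c => J.IsSpectralDecomposition x (J.eigenvalues x) c)
  by_cases h : ∃ lam : Fin J.rank → ℝ, ∃ c : Fin J.rank → V, J.IsSpectralDecomposition x lam c
  · rw [eigenvalues, dif_pos h]
    exact h.choose_spec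
  · exact absurd (by simp [trace, eigenvalues, h]) hx

end Algebra

/-! ### Geometry of the cone under the trace inner product -/

section TraceForm

variable {V : Type*} [NormedAddCommGroup V] [InnerProductSpace ℝ V]
  {J : EuclideanJordanAlgebra V}

theorem trace_eq_inner (hJ : ∀ x y : V, inner ℝ x y = J.trace (J.mul x y)) (x : V) :
    J.trace x = inner ℝ x J.one := by
  rw [hJ, J.mul_one]

theorem IsIdempotent.inner_self_eq (hJ : ∀ x y : V, inner ℝ x y = J.trace (J.mul x y)) {c : V}
    (hc : J.IsIdempotent c) : inner ℝ c c = inner ℝ c J.one := by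
  rw [hJ, show J.mul c c = c from hc, trace_eq_inner hJ]

theorem IsJordanFrame.inner_eq (hJ : ∀ x y : V, inner ℝ x y = J.trace (J.mul x y))
    {c : Fin J.rank → V} (hc : J.IsJordanFrame c) (i j : Fin J.rank) :
    inner ℝ (c i) (c j) = if i = j then inner ℝ (c i) J.one else 0 := by
  rw [hJ, hc.mul_eq, trace_eq_inner hJ]
  split_ifs <;> simp

theorem IsJordanFrame.inner_sum (hJ : ∀ x y : V, inner ℝ x y = J.trace (J.mul x y))
    {c : Fin J.rank → V} (hc : J.IsJordanFrame c) (a : Fin J.rank → ℝ) (i : Fin J.rank) :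
    inner ℝ (c i) (∑ j, a j • c j) = a i * inner ℝ (c i) J.one := by
  simp [_root_.inner_sum, inner_smul_right, hc.inner_eq hJ]

/-- The trace of `c` is `‖c‖² > 0`, so `c` has a spectral decomposition; comparing coefficients in
`c ∘ c = c` shows its eigenvalues are `0` or `1`, and they cannot all vanish. -/
theorem IsIdempotent.one_le_inner (hJ : ∀ x y : V, inner ℝ x y = J.trace (J.mul x y)) {c : V}
    (hc : J.IsIdempotent c) (h0 : c ≠ 0) : 1 ≤ inner ℝ c J.one := by
  have hpos : 0 < J.trace c := by
    rw [trace_eq_inner hJ, ← hc.inner_self_eq hJ]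
    exact real_inner_self_pos.mpr h0
  obtain ⟨hd, hs⟩ := exists_isSpectralDecomposition_of_trace_ne_zero hpos.ne'
  set l := J.eigenvalues c with hl
  set d := Classical.epsilon fun d => J.IsSpectralDecomposition c l d
  have hll : ∀ i, l i = 0 ∨ l i = 1 := fun i => by
    have h : J.mul c c = c := hc
    rw [hs, hd.sum_mul_sum] at h
    have h' := congrArg (fun w => inner ℝ (d i) w) h
    simp only [hd.inner_sum hJ] at h'
    have hdi : inner ℝ (d i) J.one ≠ 0 := by
      rw [← IsIdempotent.inner_self_eq hJ (hd.primitive i).1]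
      exact (real_inner_self_pos.mpr (hd.ne_zero i)).ne'
    have h'' := mul_right_cancel₀ hdi h'
    rcases eq_or_ne (l i) 0 with h0 | h0
    · exact Or.inl h0
    · exact Or.inr (mul_right_cancel₀ h0 (by rw [h'', one_mul]))
  rw [← trace_eq_inner hJ]
  have hne : ∃ i, l i ≠ 0 := by
    by_contra! h
    exact hpos.ne' (Finset.sum_eq_zero fun i _ => h i)
  obtain ⟨i, hi⟩ := hne
  calc (1 : ℝ) = l i := ((hll i).resolve_left hi).symm
    _ ≤ ∑ j, l j := Finset.single_le_sum
      (fun j _ => by rcases hll j with h | h <;> simp [h]) (Finset.mem_univ i)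

theorem IsJordanFrame.one_le_inner (hJ : ∀ x y : V, inner ℝ x y = J.trace (J.mul x y))
    {c : Fin J.rank → V} (hc : J.IsJordanFrame c) (i : Fin J.rank) : 1 ≤ inner ℝ (c i) J.one :=
  IsIdempotent.one_le_inner hJ (hc.primitive i).1 (hc.ne_zero i)

/-- The trace is linear, being the pairing with `e`, so a shift by a multiple of `e` makes it equal
to `1`; the shifted vector then decomposes, and shifting back only translates the eigenvalues. -/
theorem exists_isSpectralDecomposition (hJ : ∀ x y : V, inner ℝ x y = J.trace (J.mul x y))
    (h1 : J.one ≠ 0) (v : V) :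
    ∃ (lam : Fin J.rank → ℝ) (c : Fin J.rank → V), J.IsSpectralDecomposition v lam c := by
  have he : inner ℝ J.one J.one ≠ 0 := (real_inner_self_pos.mpr h1).ne'
  obtain ⟨s, hs⟩ : ∃ s : ℝ, J.trace (v + s • J.one) ≠ 0 := by
    refine ⟨(1 - inner ℝ v J.one) / inner ℝ J.one J.one, ?_⟩
    rw [trace_eq_inner hJ, inner_add_left, inner_smul_left]
    simp only [conj_trivial]
    rw [div_mul_cancel₀ _ he]
    simp
  obtain ⟨hd, h⟩ := exists_isSpectralDecomposition_of_trace_ne_zero hs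
  refine ⟨fun i => J.eigenvalues (v + s • J.one) i - s, _, hd, ?_⟩
  simp only [sub_smul, Finset.sum_sub_distrib, ← Finset.smul_sum, hd.sum_eq_one]
  rw [← h, add_sub_cancel_right]

/-- The squares are the vectors on which an associative form takes nonnegative values against
all idempotents. -/
theorem mem_squares_iff (hJ : ∀ x y : V, inner ℝ x y = J.trace (J.mul x y)) (h1 : J.one ≠ 0)
    {B : V →ₗ[ℝ] V →ₗ[ℝ] ℝ} (hB : ∀ x y z : V, B (J.mul x y) z = B x (J.mul y z))
    (hpos : ∀ x : V, x ≠ 0 → 0 < B x x) {v : V} :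
    v ∈ J.squares ↔ ∀ c, J.IsIdempotent c → 0 ≤ B v c := by
  refine ⟨?_, fun h => ?_⟩
  · rintro ⟨x, rfl⟩ c hc
    exact hc.form_sq_nonneg hB hpos x
  · obtain ⟨l, c, hc, rfl⟩ := exists_isSpectralDecomposition hJ h1 v
    -- Frame elements are also `B`-orthogonal, so pairing with `c i` isolates the sign of `l i`.
    refine hc.mem_squares fun i => ?_
    have hi := h (c i) (hc.primitive i).1
    obtain ⟨b, hb⟩ : ∃ b, B (c i) (c i) = b := ⟨_, rfl⟩
    have horth : ∀ j, B (c j) (c i) = if j = i then b else 0 := fun j => by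
      split_ifs with hji
      · rw [hji, hb]
      · have := hB (c j) (c i) (c i)
        rw [hc.orthogonal j i hji, show J.mul (c i) (c i) = c i from (hc.primitive i).1] at this
        rw [map_zero, LinearMap.zero_apply] at this
        exact this.symm
    simp only [map_sum, LinearMap.sum_apply, map_smul, LinearMap.smul_apply, horth,
      smul_eq_mul, mul_ite, mul_zero, Finset.sum_ite_eq', Finset.mem_univ, if_true] at hi
    exact nonneg_of_mul_nonneg_left hi (hb ▸ hpos _ (hc.ne_zero i))

theorem convex_squares (hJ : ∀ x y : V, inner ℝ x y = J.trace (J.mul x y)) (h1 : J.one ≠ 0) :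
    Convex ℝ J.squares := by
  obtain ⟨B, hB, hpos⟩ := J.exists_form
  intro x hx y hy a b ha hb _
  rw [mem_squares_iff hJ h1 hB hpos] at *
  intro c hc
  simp only [map_add, map_smul, LinearMap.add_apply, LinearMap.smul_apply, smul_eq_mul]
  exact add_nonneg (mul_nonneg ha (hx c hc)) (mul_nonneg hb (hy c hc))

theorem add_mem_squares (hJ : ∀ x y : V, inner ℝ x y = J.trace (J.mul x y)) (h1 : J.one ≠ 0)
    {x y : V} (hx : x ∈ J.squares) (hy : y ∈ J.squares) : x + y ∈ J.squares := by
  have h := convex_squares hJ h1 (smul_mem_squares hx zero_le_two)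
    (smul_mem_squares hy zero_le_two) one_half_pos.le one_half_pos.le (add_halves 1)
  simpa [smul_smul] using h

theorem isClosed_squares [FiniteDimensional ℝ V]
    (hJ : ∀ x y : V, inner ℝ x y = J.trace (J.mul x y)) (h1 : J.one ≠ 0) :
    IsClosed J.squares := by
  obtain ⟨B, hB, hpos⟩ := J.exists_form
  have h : J.squares = ⋂ c, ⋂ (_ : J.IsIdempotent c), {v | 0 ≤ B.flip c v} := by
    ext v
    rw [mem_squares_iff hJ h1 hB hpos]
    simp only [mem_iInter]
    rfl
  rw [h]
  exact isClosed_iInter fun c => isClosed_iInter fun _ =>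
    isClosed_le continuous_const (LinearMap.continuous_of_finiteDimensional _)

/-- Cauchy–Schwarz against `c i` gives `|l i| ‖c i‖ ≤ ‖h‖`, and `‖c i‖ ≥ 1`, so no eigenvalue of `h`
is below `-1`. This puts a ball around `e` inside the cone. -/
theorem one_add_mem_squares (hJ : ∀ x y : V, inner ℝ x y = J.trace (J.mul x y)) (h1 : J.one ≠ 0)
    {h : V} (hh : ‖h‖ ≤ 1) : J.one + h ∈ J.squares := by
  obtain ⟨l, c, hc, rfl⟩ := exists_isSpectralDecomposition hJ h1 h
  have he : J.one + ∑ i, l i • c i = ∑ i, (1 + l i) • c i := by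
    simp only [add_smul, one_smul, Finset.sum_add_distrib, hc.sum_eq_one]
  rw [he]
  refine hc.mem_squares fun i => ?_
  have hci := hc.one_le_inner hJ i
  have hn : ‖c i‖ ^ 2 = inner ℝ (c i) J.one := by
    rw [← real_inner_self_eq_norm_sq, IsIdempotent.inner_self_eq hJ (hc.primitive i).1]
  have hcs := abs_real_inner_le_norm (c i) (∑ j, l j • c j)
  rw [hc.inner_sum hJ] at hcs
  have h₁ := (abs_le.mp hcs).1
  have h₂ : ‖c i‖ * ‖∑ j, l j • c j‖ ≤ ‖c i‖ * 1 :=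
    mul_le_mul_of_nonneg_left hh (norm_nonneg _)
  have hN : 1 ≤ ‖c i‖ := (one_le_sq_iff₀ (norm_nonneg _)).mp (hn ▸ hci)
  by_contra! hlt
  nlinarith [mul_pos (neg_pos.mpr hlt) (zero_lt_one.trans_le hci)]

theorem smul_one_add_mem_openCone (hJ : ∀ x y : V, inner ℝ x y = J.trace (J.mul x y))
    (h1 : J.one ≠ 0) {m : ℝ} (hm : 0 < m) {x : V} (hx : x ∈ J.squares) :
    m • J.one + x ∈ J.openCone := by
  refine mem_interior.mpr ⟨Metric.ball (m • J.one + x) m, fun y hy => ?_, Metric.isOpen_ball,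
    Metric.mem_ball_self hm⟩
  change y ∈ J.squares
  have hy' : y = m • (J.one + m⁻¹ • (y - (m • J.one + x))) + x := by
    rw [smul_add, smul_smul, mul_inv_cancel₀ hm.ne']
    module
  rw [hy']
  refine add_mem_squares hJ h1 (smul_mem_squares (one_add_mem_squares hJ h1 ?_) hm.le) hx
  rw [norm_smul, norm_inv, Real.norm_of_nonneg hm.le, ← dist_eq_norm, inv_mul_le_one₀ hm]
  exact (Metric.mem_ball.mp hy).le

theorem closure_openCone_eq {J : EuclideanJordanAlgebra V} (hc : Convex ℝ J.squares)
    (hcl : IsClosed J.squares) (hne : J.openCone.Nonempty) : closure J.openCone = J.squares :=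
  (hc.closure_interior_eq_closure_of_nonempty_interior hne).trans hcl.closure_eq

theorem closure_openCone [FiniteDimensional ℝ V]
    (hJ : ∀ x y : V, inner ℝ x y = J.trace (J.mul x y)) (h1 : J.one ≠ 0) :
    closure J.openCone = J.squares :=
  closure_openCone_eq (convex_squares hJ h1) (isClosed_squares hJ h1)
    ⟨_, smul_one_add_mem_openCone hJ h1 one_pos (isIdempotent_one J).mem_squares⟩

theorem convex_spectraplex (J : EuclideanJordanAlgebra V) (h : Convex ℝ (closure J.openCone)) :
    Convex ℝ J.spectraplex := by
  refine h.inter fun x hx y hy a b _ _ hab => ?_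
  change inner ℝ J.one x = 1 at hx
  change inner ℝ J.one y = 1 at hy
  change inner ℝ J.one (a • x + b • y) = 1
  simp [inner_add_right, inner_smul_right, hx, hy, hab]

/-- Since `‖c i‖² = trace (c i) ≥ 1`, also `‖c i‖ ≤ trace (c i)`; the triangle inequality then
applies to the nonnegative spectral sum. It places the spectraplex in the unit ball. -/
theorem norm_le_inner_one_of_mem_squares (hJ : ∀ x y : V, inner ℝ x y = J.trace (J.mul x y))
    (h1 : J.one ≠ 0) {x : V} (hx : x ∈ J.squares) : ‖x‖ ≤ inner ℝ J.one x := by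
  obtain ⟨l, c, hc, hxl⟩ := exists_isSpectralDecomposition hJ h1 x
  obtain ⟨B, hB, hpos⟩ := J.exists_form
  have hl : ∀ i, 0 ≤ l i * inner ℝ (c i) J.one := fun i => by
    have h := (mem_squares_iff hJ h1 hB hpos).mp hx (c i) (hc.primitive i).1
    have h' : B x (c i) = l i * B (c i) (c i) := by
      have hx' : J.mul x (c i) = l i • c i := by
        simp only [hxl, map_sum, LinearMap.sum_apply, map_smul, LinearMap.smul_apply, hc.mul_eq]
        simp
      have := hB x (c i) (c i)
      rw [hx', show J.mul (c i) (c i) = c i from (hc.primitive i).1] at this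
      rw [← this]; simp
    rw [h'] at h
    exact mul_nonneg (nonneg_of_mul_nonneg_left h (hpos _ (hc.ne_zero i)))
      (zero_le_one.trans (hc.one_le_inner hJ i))
  have hnorm : ∀ i, ‖l i • c i‖ ≤ l i * inner ℝ (c i) J.one := fun i => by
    have h1i := hc.one_le_inner hJ i
    refine abs_le_of_sq_le_sq' ?_ (hl i) |>.2
    rw [norm_smul, mul_pow, ← real_inner_self_eq_norm_sq (c i),
      IsIdempotent.inner_self_eq hJ (hc.primitive i).1, Real.norm_eq_abs, sq_abs, mul_pow]
    exact mul_le_mul_of_nonneg_left (by nlinarith) (sq_nonneg _)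
  calc ‖x‖ = ‖∑ i, l i • c i‖ := by rw [← hxl]
    _ ≤ ∑ i, l i * inner ℝ (c i) J.one := norm_sum_le_of_le _ fun i _ => hnorm i
    _ = inner ℝ J.one x := by
      rw [real_inner_comm, hxl, sum_inner]
      simp [inner_smul_left]

theorem mem_openCone_of_inner_pos [FiniteDimensional ℝ V]
    (hJ : ∀ x y : V, inner ℝ x y = J.trace (J.mul x y)) (h1 : J.one ≠ 0) {v : V} {m : ℝ}
    (hm : 0 < m) (h : ∀ u ∈ J.spectraplex, m ≤ inner ℝ u v) : v ∈ J.openCone := by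
  obtain ⟨l, c, hc, rfl⟩ := exists_isSpectralDecomposition hJ h1 v
  have he : ∑ i, l i • c i = m • J.one + ∑ i, (l i - m) • c i := by
    simp only [sub_smul, Finset.sum_sub_distrib, ← Finset.smul_sum, hc.sum_eq_one]
    abel
  rw [he]
  refine smul_one_add_mem_openCone hJ h1 hm (hc.mem_squares fun i => sub_nonneg.mpr ?_)
  have hi : 0 < inner ℝ (c i) J.one := zero_lt_one.trans_le (hc.one_le_inner hJ i)
  -- The frame element scaled to trace `1` lies in the spectraplex and reads off exactly `l i`.
  have hu := h ((inner ℝ (c i) J.one)⁻¹ • c i) ⟨?_, ?_⟩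
  · rwa [real_inner_smul_left, hc.inner_sum hJ, _root_.mul_comm (l i),
      inv_mul_cancel_left₀ hi.ne'] at hu
  · rw [closure_openCone hJ h1]
    exact smul_mem_squares (IsIdempotent.mem_squares (hc.primitive i).1) (inv_nonneg.mpr hi.le)
  · rw [inner_smul_right, real_inner_comm (c i), inv_mul_cancel₀ hi.ne']

/-- If the nearest point were longer than `v`, shrinking it to length `‖v‖` would stay in the cone
and come strictly closer to `v`. -/
theorem norm_posPart_le [FiniteDimensional ℝ V]
    (hJ : ∀ x y : V, inner ℝ x y = J.trace (J.mul x y)) (h1 : J.one ≠ 0) (v : V) :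
    ‖J.posPart v‖ ≤ ‖v‖ := by
  unfold posPart
  split_ifs with h
  · obtain ⟨hp, hmin⟩ := h.choose_spec
    set p := h.choose
    rw [closure_openCone hJ h1] at hp hmin
    by_contra! hlt
    have hp0 : 0 < ‖p‖ := (norm_nonneg v).trans_lt hlt
    have hs0 : 0 ≤ ‖v‖ / ‖p‖ := by positivity
    have hs1 : ‖v‖ / ‖p‖ < 1 := (div_lt_one hp0).mpr hlt
    have hsp : ‖v‖ / ‖p‖ * ‖p‖ = ‖v‖ := div_mul_cancel₀ _ hp0.ne'
    set s := ‖v‖ / ‖p‖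
    have hle := pow_le_pow_left₀ (norm_nonneg _) (hmin _ (smul_mem_squares hp hs0)) 2
    rw [norm_sub_sq_real, norm_sub_sq_real, norm_smul, inner_smul_right,
      Real.norm_of_nonneg hs0, hsp] at hle
    have hcs := real_inner_le_norm v p
    nlinarith [mul_le_mul_of_nonneg_left hcs (sub_nonneg.mpr hs1.le), mul_pos hp0 hp0,
      mul_pos (sub_pos.mpr hs1) (mul_pos hp0 (sub_pos.mpr hlt))]
  · simp

/-- The operator norm of a vector of trace `1` is at least `1 / r`. -/
theorem one_le_rank_mul_opNorm (hJ : ∀ x y : V, inner ℝ x y = J.trace (J.mul x y)) {x : V}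
    (hx : inner ℝ J.one x = 1) : 1 ≤ J.rank * J.opNorm x := by
  rw [real_inner_comm, ← trace_eq_inner hJ] at hx
  calc (1 : ℝ) = ∑ i, J.eigenvalues x i := hx.symm
    _ ≤ ∑ _i : Fin J.rank, J.opNorm x :=
      Finset.sum_le_sum fun i _ => (le_abs_self _).trans (norm_le_pi_norm (J.eigenvalues x) i)
    _ = J.rank * J.opNorm x := by simp

end TraceForm

/-! ### The nonnegative orthant in coordinates -/

section Orthant

variable {n : ℕ}

theorem orthant_squares : (orthant n).squares = {x | ∀ i, 0 ≤ x i} := by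
  ext x
  refine ⟨?_, fun hx => ⟨WithLp.toLp 2 fun i => √(x i), ?_⟩⟩
  · rintro ⟨y, rfl⟩ i
    exact mul_self_nonneg (y i)
  · ext i
    exact (Real.mul_self_sqrt (hx i)).symm

theorem convex_orthant_squares : Convex ℝ (orthant n).squares := by
  rw [orthant_squares]
  intro x hx y hy a b ha hb _ i
  exact add_nonneg (mul_nonneg ha (hx i)) (mul_nonneg hb (hy i))

theorem orthant_closure_openCone :
    closure (orthant n).openCone = {x | ∀ i, 0 ≤ x i} := by
  rw [closure_openCone_eq convex_orthant_squares, orthant_squares]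
  · rw [orthant_squares, ofPred_forall]
    exact isClosed_iInter fun i => isClosed_le continuous_const (by fun_prop)
  · refine ⟨WithLp.toLp 2 fun _ => 1, mem_interior.mpr ⟨{x | ∀ i, 0 < x i}, ?_, ?_, ?_⟩⟩
    · change _ ⊆ (orthant n).squares
      rw [orthant_squares]
      exact fun x hx i => (hx i).le
    · rw [ofPred_forall]
      exact isOpen_iInter_of_finite fun i => isOpen_lt continuous_const (by fun_prop)
    · simp

theorem mem_orthant_spectraplex {x : EuclideanSpace ℝ (Fin n)} :
    x ∈ (orthant n).spectraplex ↔ (∀ i, 0 ≤ x i) ∧ ∑ i, x i = 1 := by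
  have h : inner ℝ (orthant n).one x = ∑ i, x i := by
    simp [orthant, PiLp.inner_apply]
  change x ∈ closure (orthant n).openCone ∧ _ = (1 : ℝ) ↔ _
  rw [orthant_closure_openCone, h]
  rfl

theorem norm_le_one_of_mem_orthant_spectraplex {x : EuclideanSpace ℝ (Fin n)}
    (hx : x ∈ (orthant n).spectraplex) : ‖x‖ ≤ 1 := by
  obtain ⟨h0, h1⟩ := mem_orthant_spectraplex.mp hx
  rw [EuclideanSpace.norm_eq, Real.sqrt_le_one]
  simp only [Real.norm_eq_abs, sq_abs]
  calc ∑ i, x i ^ 2 ≤ ∑ i, x i := Finset.sum_le_sum fun i _ => by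
        have : x i ≤ 1 := h1 ▸ Finset.single_le_sum (fun j _ => h0 j) (Finset.mem_univ i)
        nlinarith [h0 i]
    _ = 1 := h1

theorem single_mem_orthant_spectraplex (i : Fin n) :
    EuclideanSpace.single i (1 : ℝ) ∈ (orthant n).spectraplex := by
  refine mem_orthant_spectraplex.mpr ⟨fun j => ?_, ?_⟩
  · by_cases h : j = i <;> simp [h]
  · simp

end Orthant

end EuclideanJordanAlgebra

/-! ### Convergence rate of the scheme and the iteration bounds -/

/-- If every minimizer in `Δ` makes a nonpositive inner product with `P z` until the scheme halts,
then `‖P z_t‖² ≤ 1 / (t + 1)`. -/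
theorem IsVonNeumannRun.norm_sq_le {E : Type*} [NormedAddCommGroup E] [InnerProductSpace ℝ E]
    {Δ : Set E} (hconv : Convex ℝ Δ) (hnorm : ∀ u ∈ Δ, ‖u‖ ≤ 1)
    {L : Submodule ℝ E} [L.HasOrthogonalProjection] {halts : E → Prop}
    (hhalt : ∀ x ∈ Δ, ∀ m : ℝ, 0 < m →
      (∀ u ∈ Δ, m ≤ inner ℝ u (L.starProjection x)) → halts x)
    {z : ℕ → E} (hz : IsVonNeumannRun Δ (fun x => L.starProjection x) halts z) (t : ℕ)
    (ht : ∀ s < t, ¬ halts (z s)) :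
    z t ∈ Δ ∧ ‖L.starProjection (z t)‖ ^ 2 ≤ 1 / (t + 1) := by
  have hP : ∀ u ∈ Δ, ‖L.starProjection u‖ ≤ 1 := fun u hu =>
    (L.norm_starProjection_apply_le u).trans (hnorm u hu)
  induction t with
  | zero =>
    refine ⟨hz.init, ?_⟩
    simpa using hP _ hz.init
  | succ t ih =>
    obtain ⟨hzt, hb⟩ := ih fun s hs => ht s (hs.trans t.lt_succ_self)
    obtain ⟨u, hu, θ, hθ, humin, hθmin, hstep⟩ := hz.step t (ht t t.lt_succ_self)
    refine ⟨?_, ?_⟩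
    · rw [hstep]
      exact hconv.add_smul_sub_mem hzt hu hθ
    -- A positive value would be a lower bound `m` on all of `Δ`, making the scheme halt at `z t`.
    · have hin : inner ℝ (L.starProjection (z t)) (L.starProjection u) ≤ 0 := by
        by_contra! hlt
        refine ht t t.lt_succ_self (hhalt _ hzt _ hlt fun w hw => ?_)
        have h := isMinOn_iff.mp humin w hw
        have h' : inner ℝ (L.starProjection (z t)) (L.starProjection u) =
            inner ℝ u (L.starProjection (z t)) := by
          rw [real_inner_comm, L.inner_starProjection_left_eq_right,
            L.starProjection_eq_self_iff.mpr (L.starProjection_apply_mem _)]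
        rw [h']; exact h
      have hpos : (0 : ℝ) < t + 1 := by positivity
      have hpos' : (0 : ℝ) < t + 2 := by positivity
      -- The optimal step is at least as good as `1 / (t + 2)`, whose weights turn `1 / (t + 1)`
      -- into exactly `1 / (t + 2)` once the cross term is dropped.
      have hσ : (1 : ℝ) / (t + 2) ∈ Icc (0 : ℝ) 1 :=
        ⟨by positivity, by rw [div_le_one hpos']; linarith⟩
      have hle := isMinOn_iff.mp hθmin _ hσ
      rw [hstep]
      refine hle.trans ?_
      have hexp : L.starProjection (z t + (1 / (t + 2 : ℝ)) • (u - z t)) =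
          ((t + 1 : ℝ) / (t + 2)) • L.starProjection (z t) +
            (1 / (t + 2 : ℝ)) • L.starProjection u := by
        have : (t + 1 : ℝ) / (t + 2) = 1 - 1 / (t + 2) := by field_simp; ring
        rw [this]
        simp only [map_add, map_smul, map_sub]
        module
      rw [hexp, norm_add_sq_real, norm_smul, norm_smul, inner_smul_left, inner_smul_right,
        conj_trivial, Real.norm_of_nonneg (by positivity), Real.norm_of_nonneg (by positivity),
        mul_pow, mul_pow]
      have hq : ‖L.starProjection u‖ ^ 2 ≤ 1 := pow_le_one₀ (norm_nonneg _) (hP u hu)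
      have h₁ : 2 * ((t + 1 : ℝ) / (t + 2) * (1 / (t + 2) *
          inner ℝ (L.starProjection (z t)) (L.starProjection u))) ≤ 0 := by
        have : 0 ≤ (t + 1 : ℝ) / (t + 2) * (1 / (t + 2)) := by positivity
        nlinarith
      have h₂ := mul_le_mul_of_nonneg_left hb (sq_nonneg ((t + 1 : ℝ) / (t + 2)))
      have h₃ := mul_le_mul_of_nonneg_left hq (sq_nonneg (1 / (t + 2 : ℝ)))
      have h₄ : ((t + 1 : ℝ) / (t + 2)) ^ 2 * (1 / (t + 1)) + (1 / (t + 2 : ℝ)) ^ 2 * 1 =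
          1 / (((t + 1 : ℕ) : ℝ) + 1) := by
        push_cast
        field_simp
        ring
      linarith

theorem mainTheorem10 :
    (∀ (V : Type*) [NormedAddCommGroup V] [InnerProductSpace ℝ V] [FiniteDimensional ℝ V]
      (J : EuclideanJordanAlgebra V)
      -- `V` carries the trace inner product of the algebra
      (_hJ : ∀ x y : V, inner ℝ x y = J.trace (J.mul x y))
      (L : Submodule ℝ V) (z : ℕ → V),
      IsVonNeumannRun J.spectraplex (fun x => L.starProjection x)
        (SymmetricStop J (fun x => L.starProjection x)) z →
      ∃ t : ℕ, t ≤ 16 * J.rank ^ 4 ∧ SymmetricStop J (fun x => L.starProjection x) (z t)) ∧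
    (∀ (n : ℕ) (L : Submodule ℝ (EuclideanSpace ℝ (Fin n)))
      (z : ℕ → EuclideanSpace ℝ (Fin n)),
      IsVonNeumannRun (EuclideanJordanAlgebra.orthant n).spectraplex
        (fun x => L.starProjection x) (OrthantStop (fun x => L.starProjection x)) z →
      ∃ t : ℕ, t ≤ 9 * n ^ 3 ∧ OrthantStop (fun x => L.starProjection x) (z t)) := by
  open EuclideanJordanAlgebra in
  refine ⟨fun V _ _ _ J hJ L z hz => ?_, fun n L z hz => ?_⟩
  -- If `e = 0`, the spectraplex is empty and no run can start.
  · have h1 : J.one ≠ 0 := fun h => by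
      have := hz.init.2
      simp [h] at this
    by_contra! hcon
    obtain ⟨hmem, hle⟩ := hz.norm_sq_le
      (convex_spectraplex J (closure_openCone hJ h1 ▸ convex_squares hJ h1))
      (fun u hu => by
        have h := norm_le_inner_one_of_mem_squares hJ h1 (closure_openCone hJ h1 ▸ hu.1)
        rwa [hu.2] at h)
      (fun x _ m hm h => Or.inl (mem_openCone_of_inner_pos hJ h1 hm h))
      (16 * J.rank ^ 4) (fun s hs => hcon s hs.le)
    refine hcon _ le_rfl (Or.inr ((norm_posPart_le hJ h1 _).trans ?_))
    have hop := one_le_rank_mul_opNorm hJ hmem.2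
    set y := z (16 * J.rank ^ 4)
    have hr : (0 : ℝ) < J.rank := by
      rcases J.rank.eq_zero_or_pos with h | h
      · rw [h] at hop; norm_num at hop
      · exact_mod_cast h
    -- At `t = 16 r⁴` the rate is `1 / (16 r⁴ + 1)`, below the square of `1 / (4 r²)`.
    have h₁ : ‖L.starProjection y‖ ≤ 1 / (4 * (J.rank : ℝ) ^ 2) := by
      refine abs_le_of_sq_le_sq' (hle.trans ?_) (by positivity) |>.2
      rw [div_pow, one_pow]
      exact one_div_le_one_div_of_le (by positivity) (by push_cast; nlinarith)
    refine h₁.trans ?_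
    rw [div_mul_eq_mul_div, one_mul, div_le_div_iff₀ (by positivity) (by positivity)]
    nlinarith [mul_le_mul_of_nonneg_left hop hr.le]
  · by_contra! hcon
    obtain ⟨hmem, hle⟩ := hz.norm_sq_le
      (convex_spectraplex _ (by
        rw [orthant_closure_openCone, ← orthant_squares]; exact convex_orthant_squares))
      (fun u hu => norm_le_one_of_mem_orthant_spectraplex hu)
      (fun x _ m hm h => Or.inl fun i => by
        -- The vertices of the simplex read off the coordinates.
        have := h _ (single_mem_orthant_spectraplex i)
        rw [EuclideanSpace.inner_single_left, map_one, one_mul] at this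
        exact hm.trans_le this)
      (9 * n ^ 3) (fun s hs => hcon s hs.le)
    refine hcon _ le_rfl (Or.inr ?_)
    set y := z (9 * n ^ 3)
    have hop : 1 ≤ n * ‖WithLp.ofLp y‖ := by
      calc (1 : ℝ) = ∑ i, y i := (mem_orthant_spectraplex.mp hmem).2.symm
        _ ≤ ∑ _i : Fin n, ‖WithLp.ofLp y‖ :=
          Finset.sum_le_sum fun i _ => (le_abs_self _).trans (norm_le_pi_norm (WithLp.ofLp y) i)
        _ = n * ‖WithLp.ofLp y‖ := by simp
    have hn : (0 : ℝ) < n := by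
      rcases n.eq_zero_or_pos with h | h
      · rw [show (n : ℝ) = 0 by exact_mod_cast h] at hop; norm_num at hop
      · exact_mod_cast h
    have hpp : ‖(WithLp.toLp 2 (fun i => max (L.starProjection y i) 0) :
        EuclideanSpace ℝ (Fin n))‖ ≤ ‖L.starProjection y‖ := by
      rw [EuclideanSpace.norm_eq, EuclideanSpace.norm_eq]
      refine Real.sqrt_le_sqrt (Finset.sum_le_sum fun i _ => ?_)
      refine pow_le_pow_left₀ (norm_nonneg _) ?_ 2
      rw [Real.norm_of_nonneg (le_max_right _ _)]
      exact max_le (le_abs_self _) (abs_nonneg _)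
    refine hpp.trans ?_
    have hs : 0 < √(n : ℝ) := Real.sqrt_pos.mpr hn
    have hss : √(n : ℝ) ^ 2 = n := Real.sq_sqrt hn.le
    have h₁ : ‖L.starProjection y‖ ≤ 1 / (3 * √(n : ℝ) * n) := by
      refine abs_le_of_sq_le_sq' (hle.trans ?_) (by positivity) |>.2
      rw [div_pow, one_pow]
      refine one_div_le_one_div_of_le (by positivity) ?_
      rw [mul_pow, mul_pow, hss]
      push_cast
      nlinarith
    refine h₁.trans ?_
    rw [div_mul_eq_mul_div, one_mul, div_le_div_iff₀ (by positivity) (by positivity)]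
    nlinarith [mul_le_mul_of_nonneg_left hop (mul_pos three_pos hs).le]
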